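/- Fix $\gamma>0$, $0<b<c<d$, a compact set $\mathcal K\subset C^\infty([0,d];\mathbb R)$ (with its Fréchet topology) and a compact set $K\subset(0,+\infty)$. Let $\mathcal V$ be the set of all potentials $V:[0,\infty)\to\mathbb R$ that are continuous on $[0,\infty)$, smooth on $(0,\infty)$, with $V(0)=0$, and for which there is a smooth $W$ on $[0,\infty)$ such that $W(0)>0$, $V(x)=x^\gamma W(x)$ for all $x>0$, and - $V'(x)>0$ for all $x\in(0,d]$, and $V(x)\ge V(d)$ for all $x\ge d$; - $W|_{[0,d]}\in\mathcal K$; - for every $E\in K$: $E-V(x)>0$ for all $x\in[0,b]$, and $V(x)-E>0$ for all $x\in[c,d]$. Assume that the set $\{W|_{[0,d]} : V=x^\gamma W\in\mathcal V\}$ is closed (hence compact) in $C^\infty([0,d];\mathbb R)$. For $h>0$, $V\in\mathcal V$ and $E\in K$, let $G_h(\cdot\,;E)$ (which also depends on $V$) be the unique solution of $-h^2G''+VG=EG$ on the half-line such that $\int_0^{\infty}|G_h(x;E)|^2\,dx=1$ and $G_h(x;E)>0$ for all $x\ge d$. Then there are constants $\mathbf c>0$ and $h_0>0$ (depending only on $\gamma,b,c,d,\mathcal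 K,K$) such that $$\int_0^b |G_h(x;E)|^2\,dx\ \ge\ \mathbf c\qquad\text{for all } 0<h\le h_0 \text{ and all } (V,E)\in\mathcal V\times K .$$ -/

import Mathlib

open Set MeasureTheory
open scoped ContDiff

noncomputable section

namespace SchrodingerWell

/-- Extension by zero of a function on `[0,d]` to the real line. -/
def extendZero {d : ℝ} (f : Icc (0 : ℝ) d → ℝ) (x : ℝ) : ℝ :=
  if hx : x ∈ Icc (0 : ℝ) d then f ⟨x, hx⟩ else 0

/-- The space `C^∞([0,d]; ℝ)`: real functions on `[0,d]` that are smooth up to the end points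
(one-sided derivatives at `0` and at `d`). -/
def SmoothIcc (d : ℝ) : Type :=
  {f : Icc (0 : ℝ) d → ℝ // ContDiffOn ℝ ∞ (extendZero f) (Icc (0 : ℝ) d)}

namespace SmoothIcc

instance (d : ℝ) : CoeFun (SmoothIcc d) (fun _ => Icc (0 : ℝ) d → ℝ) := ⟨fun f => f.1⟩

theorem continuous_derivative {d : ℝ} (f : SmoothIcc d) (k : ℕ) :
    Continuous (fun x : Icc (0 : ℝ) d =>
      iteratedDerivWithin k (extendZero f.1) (Icc (0 : ℝ) d) (x : ℝ)) := by
  rcases lt_or_ge 0 d with hd | hd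
  · have h := f.2.continuousOn_iteratedDerivWithin (m := k)
      (by exact_mod_cast le_top) (uniqueDiffOn_Icc hd)
    exact continuousOn_iff_continuous_domRestrict.1 h
  · have : Subsingleton (Icc (0 : ℝ) d) :=
      ⟨fun x y => Subtype.ext (by
        have h1 := x.2.1; have h2 := x.2.2; have h3 := y.2.1; have h4 := y.2.2
        linarith)⟩
    exact continuous_of_const fun x y => by rw [Subsingleton.elim x y]

/-- The `k`-th derivative `f^{(k)}`, as an element of `C([0,d]; ℝ)`. -/
def derivative {d : ℝ} (k : ℕ) (f : SmoothIcc d) : C(Icc (0 : ℝ) d, ℝ) :=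
  ⟨fun x => iteratedDerivWithin k (extendZero f.1) (Icc (0 : ℝ) d) (x : ℝ),
    continuous_derivative f k⟩

/-- The Fréchet topology of `C^∞([0,d]; ℝ)`: uniform convergence on `[0,d]` of the derivatives of
every order. -/
instance (d : ℝ) : TopologicalSpace (SmoothIcc d) :=
  TopologicalSpace.induced
    (fun f : SmoothIcc d => fun k : ℕ => derivative k f) inferInstance

end SmoothIcc

/-- The assumptions on a single potential `V(x) = x^γ W(x)` on the half-line `[0,∞)`, with
reference point `d`. Only the values of `V` and `W` on `[0,∞)` matter. -/
structure IsWell (γ d : ℝ) (V W : ℝ → ℝ) : Prop where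
  smooth_V : ContDiffOn ℝ ∞ V (Ioi 0)
  continuous_V : ContinuousOn V (Ici 0)
  V_zero : V 0 = 0
  smooth_W : ContDiffOn ℝ ∞ W (Ici 0)
  V_eq : ∀ x : ℝ, 0 < x → V x = x ^ γ * W x
  W_zero_pos : 0 < W 0
  V_ge : ∀ x : ℝ, d ≤ x → V d ≤ V x
  deriv_pos : ∀ x ∈ Ioc 0 d, 0 < deriv V x

/-- `V = x^γ W` satisfies the assumptions of the family: it is a well, the restriction of `W` to
`[0,d]` belongs to `𝒦`, every energy in `K` is above `V` on `[0,b]` and below `V` on `[c,d]`. -/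
structure IsAdmissible (γ b c d : ℝ) (𝒦 : Set (SmoothIcc d)) (K : Set ℝ) (V W : ℝ → ℝ) :
    Prop where
  well : IsWell γ d V W
  restrict_mem : ∃ w ∈ 𝒦, ∀ x : Icc (0 : ℝ) d, w x = W x
  allowed : ∀ E ∈ K, ∀ x ∈ Icc 0 b, 0 < E - V x
  forbidden : ∀ E ∈ K, ∀ x ∈ Icc c d, 0 < V x - E

/-- The family `𝒱` of potentials. -/
def potentials (γ b c d : ℝ) (𝒦 : Set (SmoothIcc d)) (K : Set ℝ) : Set (ℝ → ℝ) :=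
  {V | ∃ W, IsAdmissible γ b c d 𝒦 K V W}

/-- The set of the restrictions `W|_[0,d]`, where `V = x^γ W` runs through the family `𝒱`. -/
def restrictedWeights (γ b c d : ℝ) (𝒦 : Set (SmoothIcc d)) (K : Set ℝ) : Set (SmoothIcc d) :=
  {w | ∃ V W, IsAdmissible γ b c d 𝒦 K V W ∧ ∀ x : Icc (0 : ℝ) d, w x = W x}

/-- `G` is the normalized solution `G_h(·;E)` of `-h² G'' + V G = E G` on the half-line: the
solution of unit norm in `L²(0,∞)` that is positive on `[d,∞)`. Only the values of `G` on `(0,∞)`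
matter. -/
structure IsNormalizedSolution (h d E : ℝ) (V G : ℝ → ℝ) : Prop where
  regular : ContDiffOn ℝ 2 G (Ioi 0)
  equation : ∀ x : ℝ, 0 < x → -h ^ 2 * deriv (deriv G) x + V x * G x = E * G x
  square_integrable : IntegrableOn (fun x => |G x| ^ 2) (Ioi 0)
  normalized : ∫ x in Ioi (0 : ℝ), |G x| ^ 2 = 1
  positive : ∀ x : ℝ, d ≤ x → 0 < G x

end SchrodingerWell

end

/-!
The proof is an energy argument that needs no semiclassical asymptotics. Write `u = G ^ 2` and let
`ℰ = h² G'² + (E - V) u` be the energy of the solution. Along the equation `ℰ' = -V' u`, so `ℰ` is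
nonincreasing on `(0,d]`.

* In the forbidden region `u` is convex and integrable, hence nonincreasing
  (`HasDerivSolution.mul_deriv_nonpos`). Comparing with the constant potential `V d` on `[d,∞)`
  gives `(V d - E) u ≤ h² G'²` there (`HasDerivSolution.le_sq_deriv`). In particular `0 ≤ ℰ d`, and
  `∫_d^∞ u` is at most a constant times `u d` (`HasDerivSolution.tail_le`), which is in turn
  controlled by `∫_c^d u`.
* Since `ℰ d ≥ 0`, integrating `ℰ'` yields `κ ∫_b^d u ≤ ℰ b` whenever `κ ≤ V'` on `[b,d]`
  (`HasDerivSolution.integral_le_energy`).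
* A virial identity with a cutoff supported inside `(0,b)` bounds the average of `ℰ` on `(0,b)`, and
  so also `ℰ b`, by a constant times `∫_0^b u` (`HasDerivSolution.energy_le_integral`).

Together these bound the total mass `1` by a multiple of `∫_0^b u`. The only uniformity to be
extracted from compactness is the lower bound `κ` for `V'` on `[b,d]`
(`exists_forall_le_deriv`); it also gives `V d - E ≥ κ (d - c)`.
-/

open Set MeasureTheory
open scoped ContDiff

namespace SchrodingerWell

/-! ### The equation as a first-order system -/

/-- `G` solves `-h² G'' + V G = E G` on `(0,∞)`, with `G'` named as a separate function. -/
structure HasDerivSolution (h E : ℝ) (V G G' : ℝ → ℝ) : Prop where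
  hasDerivAt : ∀ x, 0 < x → HasDerivAt G (G' x) x
  hasDerivAt' : ∀ x, 0 < x → HasDerivAt G' ((V x - E) / h ^ 2 * G x) x

theorem IsNormalizedSolution.hasDerivSolution {h d E : ℝ} {V G : ℝ → ℝ} (hh : 0 < h)
    (hG : IsNormalizedSolution h d E V G) : HasDerivSolution h E V G (deriv G) where
  hasDerivAt x hx :=
    ((hG.regular.differentiableOn (by norm_num)).differentiableAt (Ioi_mem_nhds hx)).hasDerivAt
  hasDerivAt' x hx := by
    have h2 : ContDiffOn ℝ 1 (deriv G) (Ioi 0) :=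
      hG.regular.deriv_of_isOpen isOpen_Ioi (by norm_num)
    have h3 := ((h2.differentiableOn (by norm_num)).differentiableAt (Ioi_mem_nhds hx)).hasDerivAt
    have h4 := hG.equation x hx
    refine h3.congr_deriv ?_
    field_simp
    linarith

/-! ### Monotonicity from pointwise derivatives -/

theorem monotoneOn_of_hasDerivAt_nonneg {s : Set ℝ} (hs : Convex ℝ s) {f f' : ℝ → ℝ}
    (hf : ∀ x ∈ s, HasDerivAt f (f' x) x) (hf' : ∀ x ∈ s, 0 ≤ f' x) : MonotoneOn f s :=
  monotoneOn_of_deriv_nonneg hs (fun x hx => (hf x hx).continuousAt.continuousWithinAt)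
    (fun x hx => (hf x (interior_subset hx)).differentiableAt.differentiableWithinAt)
    (fun x hx => by rw [(hf x (interior_subset hx)).deriv]; exact hf' x (interior_subset hx))

theorem antitoneOn_of_hasDerivAt_nonpos {s : Set ℝ} (hs : Convex ℝ s) {f f' : ℝ → ℝ}
    (hf : ∀ x ∈ s, HasDerivAt f (f' x) x) (hf' : ∀ x ∈ s, f' x ≤ 0) : AntitoneOn f s :=
  antitoneOn_of_deriv_nonpos hs (fun x hx => (hf x hx).continuousAt.continuousWithinAt)
    (fun x hx => (hf x (interior_subset hx)).differentiableAt.differentiableWithinAt)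
    (fun x hx => by rw [(hf x (interior_subset hx)).deriv]; exact hf' x (interior_subset hx))

theorem not_forall_le_of_integrableOn {u : ℝ → ℝ} {a ε : ℝ} (ha : 0 ≤ a) (hε : 0 < ε)
    (hu : IntegrableOn u (Ioi 0)) : ¬ ∀ x, a ≤ x → ε ≤ u x := by
  intro H
  have h1 : IntegrableOn (fun _ : ℝ => ε) (Ioi a) := by
    refine Integrable.mono' (hu.mono_set (Ioi_subset_Ioi ha)) aestronglyMeasurable_const ?_
    filter_upwards [ae_restrict_mem measurableSet_Ioi] with x hx
    rw [Real.norm_of_nonneg hε.le]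
    exact H x (le_of_lt hx)
  rw [integrableOn_const_iff] at h1
  rcases h1 with h1 | h1
  · exact hε.ne' (by simpa using h1)
  · simp at h1

namespace HasDerivSolution

variable {h E : ℝ} {V G G' : ℝ → ℝ}

theorem hasDerivAt_sq (hG : HasDerivSolution h E V G G') {x : ℝ} (hx : 0 < x) :
    HasDerivAt (fun y => G y ^ 2) (2 * (G x * G' x)) x := by
  refine HasDerivAt.congr_deriv ((hG.hasDerivAt x hx).fun_pow 2) ?_
  push_cast
  ring

theorem hasDerivAt_mul (hG : HasDerivSolution h E V G G') {x : ℝ} (hx : 0 < x) :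
    HasDerivAt (fun y => G y * G' y) (G' x ^ 2 + (V x - E) / h ^ 2 * G x ^ 2) x := by
  refine HasDerivAt.congr_deriv ((hG.hasDerivAt x hx).fun_mul (hG.hasDerivAt' x hx)) ?_
  ring

theorem continuousOn (hG : HasDerivSolution h E V G G') : ContinuousOn G (Ioi 0) :=
  fun x hx => (hG.hasDerivAt x hx).continuousAt.continuousWithinAt

theorem continuousOn' (hG : HasDerivSolution h E V G G') : ContinuousOn G' (Ioi 0) :=
  fun x hx => (hG.hasDerivAt' x hx).continuousAt.continuousWithinAt

/-! ### The forbidden region -/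

/-- In the forbidden region `G ^ 2` is convex; being integrable, it cannot increase. -/
theorem mul_deriv_nonpos (hG : HasDerivSolution h E V G G')
    (hint : IntegrableOn (fun x => G x ^ 2) (Ioi 0)) {c : ℝ} (hc : 0 < c)
    (hV : ∀ x, c ≤ x → E ≤ V x) {x : ℝ} (hx : c ≤ x) : G x * G' x ≤ 0 := by
  by_contra! hpos
  have hmono : MonotoneOn (fun y => G y * G' y) (Ici c) :=
    monotoneOn_of_hasDerivAt_nonneg (convex_Ici c)
      (fun y hy => hG.hasDerivAt_mul (hc.trans_le hy))
      (fun y hy => by have := sub_nonneg.2 (hV y hy); positivity)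
  have hmono2 : MonotoneOn (fun y => G y ^ 2) (Ici x) :=
    monotoneOn_of_hasDerivAt_nonneg (convex_Ici x)
      (fun y hy => hG.hasDerivAt_sq (hc.trans_le (hx.trans hy)))
      (fun y hy => by
        have := hmono (mem_Ici.2 hx) (mem_Ici.2 (hx.trans hy)) hy
        simp only at this
        linarith)
  have hne : G x ≠ 0 := by
    rintro h0
    simp [h0] at hpos
  exact not_forall_le_of_integrableOn (hc.le.trans hx) (by positivity : 0 < G x ^ 2) hint
    fun y hy => hmono2 self_mem_Ici (mem_Ici.2 hy) hy

/-- On `[d,∞)` the solution decays at least as fast as for the constant potential `V d`. -/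
theorem le_sq_deriv (hG : HasDerivSolution h E V G G') (hh : 0 < h)
    (hint : IntegrableOn (fun x => G x ^ 2) (Ioi 0)) {d : ℝ} (hd : 0 < d) (hE : E < V d)
    (hV : ∀ x, d ≤ x → V d ≤ V x) {x : ℝ} (hx : d ≤ x) :
    (V d - E) * G x ^ 2 ≤ h ^ 2 * G' x ^ 2 := by
  by_contra! hlt
  have hanti : AntitoneOn (fun y => h ^ 2 * G' y ^ 2 - (V d - E) * G y ^ 2) (Ici d) := by
    refine antitoneOn_of_hasDerivAt_nonpos (f' := fun y => 2 * (V y - V d) * (G y * G' y))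
      (convex_Ici d) (fun y hy => ?_) (fun y hy => ?_)
    · have hy0 : 0 < y := hd.trans_le hy
      refine HasDerivAt.congr_deriv
        ((((hG.hasDerivAt' y hy0).fun_pow 2).const_mul (h ^ 2)).fun_sub
        ((hG.hasDerivAt_sq hy0).const_mul (V d - E))) ?_
      field_simp
      push_cast
      ring
    · have h1 := hG.mul_deriv_nonpos hint hd (fun z hz => hE.le.trans (hV z hz)) hy
      have h2 := hV y hy
      exact mul_nonpos_of_nonneg_of_nonpos (by linarith) h1
  have hδ : 0 < V d - E := sub_pos.2 hE
  refine not_forall_le_of_integrableOn (hd.le.trans hx)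
    (div_pos (sub_pos.2 hlt) hδ) hint fun y hy => ?_
  have h1 := hanti (mem_Ici.2 hx) (mem_Ici.2 (hx.trans hy)) hy
  simp only at h1
  rw [div_le_iff₀ hδ]
  have : 0 ≤ h ^ 2 * G' y ^ 2 := by positivity
  linarith

/-- The mass beyond `d`, controlled by the value at `d`: there `(G ^ 2)' ≤ -2 κ G ^ 2`. -/
theorem tail_le (hG : HasDerivSolution h E V G G') (hh : 0 < h) (hh1 : h ≤ 1)
    (hint : IntegrableOn (fun x => G x ^ 2) (Ioi 0)) {d κ : ℝ} (hd : 0 < d) (hκ : 0 < κ)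
    (hE : κ ^ 2 ≤ V d - E) (hV : ∀ x, d ≤ x → V d ≤ V x) :
    2 * κ * ∫ x in Ioi d, G x ^ 2 ≤ G d ^ 2 := by
  have hE' : E < V d := by nlinarith [sq_pos_of_pos hκ]
  -- The decay rate is at least `κ / h ≥ κ`.
  have hrate : ∀ x, d ≤ x → κ * G x ^ 2 ≤ -(G x * G' x) := by
    intro x hx
    have h1 := hG.le_sq_deriv hh hint hd hE' hV hx
    have h2 := hG.mul_deriv_nonpos hint hd (fun z hz => hE'.le.trans (hV z hz)) hx
    refine le_of_sq_le_sq ?_ (by linarith)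
    have h3 : κ ^ 2 * G x ^ 2 ≤ G' x ^ 2 := by
      have : h ^ 2 ≤ 1 := pow_le_one₀ hh.le hh1
      nlinarith [sq_nonneg (G x), sq_nonneg (G' x)]
    nlinarith [sq_nonneg (G x)]
  have hbound : ∀ R, d ≤ R → 2 * κ * ∫ x in d..R, G x ^ 2 ≤ G d ^ 2 := by
    intro R hR
    have hsub : uIcc d R ⊆ Ioi 0 := by
      rw [uIcc_of_le hR]; exact fun x hx => hd.trans_le hx.1
    have hc : ContinuousOn (fun x => 2 * (G x * G' x)) (uIcc d R) :=
      ((hG.continuousOn.mono hsub).mul (hG.continuousOn'.mono hsub)).const_mul _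
    have h1 := intervalIntegral.integral_eq_sub_of_hasDerivAt
      (fun x hx => hG.hasDerivAt_sq (hsub hx)) hc.intervalIntegrable
    have h2 : ∫ x in d..R, 2 * κ * G x ^ 2 ≤ ∫ x in d..R, -(2 * (G x * G' x)) := by
      refine intervalIntegral.integral_mono_on hR
        (((hG.continuousOn.mono hsub).pow 2).const_mul _).intervalIntegrable
        hc.neg.intervalIntegrable fun x hx => ?_
      linarith [hrate x hx.1]
    rw [intervalIntegral.integral_const_mul, intervalIntegral.integral_neg, h1] at h2
    nlinarith [sq_nonneg (G R)]
  have hlim := intervalIntegral_tendsto_integral_Ioi d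
    (hint.mono_set (Ioi_subset_Ioi hd.le)) Filter.tendsto_id
  refine le_of_tendsto (hlim.const_mul (2 * κ)) ?_
  filter_upwards [Filter.eventually_ge_atTop d] with R hR using hbound R hR

/-! ### The energy -/

theorem hasDerivAt_energy (hG : HasDerivSolution h E V G G') (hh : 0 < h) {x : ℝ} (hx : 0 < x)
    (hV : DifferentiableAt ℝ V x) :
    HasDerivAt (fun y => h ^ 2 * G' y ^ 2 + (E - V y) * G y ^ 2) (-(deriv V x * G x ^ 2)) x := by
  refine HasDerivAt.congr_deriv ((((hG.hasDerivAt' x hx).fun_pow 2).const_mul (h ^ 2)).fun_add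
    ((hV.hasDerivAt.const_sub E).fun_mul (hG.hasDerivAt_sq hx))) ?_
  field_simp
  push_cast
  ring

/-- If the energy is nonnegative at `d`, its value at `b` dominates the mass of `[b,d]`. -/
theorem integral_le_energy (hG : HasDerivSolution h E V G G') (hh : 0 < h) {b d κ : ℝ}
    (hb : 0 < b) (hbd : b ≤ d) (hV : ContDiffOn ℝ ∞ V (Ioi 0))
    (hκ : ∀ x ∈ Icc b d, κ ≤ deriv V x)
    (hend : 0 ≤ h ^ 2 * G' d ^ 2 + (E - V d) * G d ^ 2) :
    κ * ∫ x in b..d, G x ^ 2 ≤ h ^ 2 * G' b ^ 2 + (E - V b) * G b ^ 2 := by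
  have hsub : uIcc b d ⊆ Ioi 0 := by
    rw [uIcc_of_le hbd]; exact fun x hx => hb.trans_le hx.1
  have hV' : ContinuousOn (deriv V) (Ioi 0) :=
    hV.continuousOn_deriv_of_isOpen isOpen_Ioi (by norm_num)
  have hu : ContinuousOn (fun x => G x ^ 2) (uIcc b d) := (hG.continuousOn.mono hsub).pow 2
  have hc : ContinuousOn (fun x => deriv V x * G x ^ 2) (uIcc b d) := (hV'.mono hsub).mul hu
  have h1 := intervalIntegral.integral_eq_sub_of_hasDerivAt
    (fun x hx => hG.hasDerivAt_energy hh (hsub hx)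
      ((hV.differentiableOn (by norm_num)).differentiableAt (Ioi_mem_nhds (hsub hx))))
    hc.neg.intervalIntegrable
  have h2 : ∫ x in b..d, κ * G x ^ 2 ≤ ∫ x in b..d, deriv V x * G x ^ 2 :=
    intervalIntegral.integral_mono_on hbd (hu.const_mul _).intervalIntegrable
      hc.intervalIntegrable fun x hx => mul_le_mul_of_nonneg_right (hκ x hx) (sq_nonneg _)
  rw [intervalIntegral.integral_const_mul] at h2
  rw [intervalIntegral.integral_neg] at h1
  linarith

/-- The virial identity: for a `C²` weight `χ` vanishing to first order at `p` and `q`, the kinetic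
energy is `∫ χ h² G'² = ∫ (χ (E - V) + h² χ'' / 2) G²`. -/
theorem virial (hG : HasDerivSolution h E V G G') (hh : 0 < h) {p q : ℝ} (hp : 0 < p)
    (hpq : p ≤ q) (hV : ContinuousOn V (Ici 0)) {χ χ' χ'' : ℝ → ℝ}
    (hχ : ∀ x, HasDerivAt χ (χ' x) x) (hχ' : ∀ x, HasDerivAt χ' (χ'' x) x)
    (hχ'' : Continuous χ'') (hχp : χ p = 0) (hχq : χ q = 0) (hχp' : χ' p = 0) (hχq' : χ' q = 0) :
    ∫ x in p..q, χ x * (h ^ 2 * G' x ^ 2) =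
      ∫ x in p..q, (χ x * (E - V x) + h ^ 2 * χ'' x / 2) * G x ^ 2 := by
  have hsub : uIcc p q ⊆ Ioi 0 := by
    rw [uIcc_of_le hpq]; exact fun x hx => hp.trans_le hx.1
  have hcχ : ContinuousOn χ (uIcc p q) := fun x _ => (hχ x).continuousAt.continuousWithinAt
  have hcV := hV.mono (hsub.trans Ioi_subset_Ici_self)
  have hcG := hG.continuousOn.mono hsub
  have hcG' := hG.continuousOn'.mono hsub
  have hc1 : ContinuousOn (fun x => χ x * (h ^ 2 * G' x ^ 2)) (uIcc p q) := by fun_prop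
  have hc2 : ContinuousOn (fun x => (χ x * (E - V x) + h ^ 2 * χ'' x / 2) * G x ^ 2)
      (uIcc p q) := by fun_prop
  have key := intervalIntegral.integral_eq_sub_of_hasDerivAt (a := p) (b := q)
    (f := fun x => h ^ 2 * (χ x * (G x * G' x) - χ' x * G x ^ 2 / 2))
    (f' := fun x => χ x * (h ^ 2 * G' x ^ 2) -
      (χ x * (E - V x) + h ^ 2 * χ'' x / 2) * G x ^ 2)
    (fun x hx => by
      refine HasDerivAt.congr_deriv ((((hχ x).fun_mul (hG.hasDerivAt_mul (hsub hx))).fun_sub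
        (((hχ' x).fun_mul (hG.hasDerivAt_sq (hsub hx))).div_const 2)).const_mul (h ^ 2)) ?_
      field_simp
      ring)
    (hc1.sub hc2).intervalIntegrable
  rw [intervalIntegral.integral_sub hc1.intervalIntegrable hc2.intervalIntegrable] at key
  simp only [hχp, hχq, hχp', hχq'] at key
  linarith

end HasDerivSolution

/-- The energy at `b` is at most a constant times the mass of `(0,b)`, the constant depending only
on `b` and an upper bound `M` of the energies. The weight in the virial identity is
`χ(x) = (x - p)² (q - x)²` with `[p,q] = [b/3, 2b/3]`. -/
theorem HasDerivSolution.energy_le_integral {b M : ℝ} (hb : 0 < b) :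
    ∃ A > (0 : ℝ), ∀ (h E : ℝ) (V G G' : ℝ → ℝ), HasDerivSolution h E V G G' → 0 < h → h ≤ 1 →
      E ≤ M → ContinuousOn V (Ici 0) → ContDiffOn ℝ ∞ V (Ioi 0) →
      (∀ x ∈ Icc 0 b, 0 ≤ V x) → (∀ x ∈ Ioc 0 b, 0 ≤ deriv V x) →
      IntegrableOn (fun x => G x ^ 2) (Ioi 0) →
      h ^ 2 * G' b ^ 2 + (E - V b) * G b ^ 2 ≤ A * ∫ x in 0..b, G x ^ 2 := by
  obtain ⟨p, q, hp, hpq, hqb⟩ : ∃ p q : ℝ, 0 < p ∧ p < q ∧ q < b :=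
    ⟨b / 3, 2 * b / 3, by positivity, by linarith, by linarith⟩
  let χ : ℝ → ℝ := fun x => ((x - p) * (q - x)) ^ 2
  let χ' : ℝ → ℝ := fun x => 2 * ((x - p) * (q - x)) * (p + q - 2 * x)
  let χ'' : ℝ → ℝ := fun x => 2 * (p + q - 2 * x) ^ 2 - 4 * ((x - p) * (q - x))
  have hin : ∀ x, HasDerivAt (fun y => (y - p) * (q - y)) (p + q - 2 * x) x := fun x => by
    refine HasDerivAt.congr_deriv
      (((hasDerivAt_id x).sub_const p).fun_mul ((hasDerivAt_id x).const_sub q)) ?_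
    simp only [id]
    ring
  have hχ : ∀ x, HasDerivAt χ (χ' x) x := fun x => by
    refine HasDerivAt.congr_deriv ((hin x).fun_pow 2) ?_
    simp only [χ']
    push_cast
    ring
  have hχ' : ∀ x, HasDerivAt χ' (χ'' x) x := fun x => by
    refine HasDerivAt.congr_deriv
      (((hin x).const_mul 2).fun_mul (((hasDerivAt_id x).const_mul 2).const_sub (p + q))) ?_
    simp only [χ'']
    ring
  have hχc : Continuous χ := by fun_prop
  have hχc'' : Continuous χ'' := by fun_prop
  have hS : 0 < ∫ x in p..q, χ x :=
    intervalIntegral.intervalIntegral_pos_of_pos_on (hχc.intervalIntegrable _ _)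
      (fun x hx => by
        have h1 := sub_pos.2 hx.1
        have h2 := sub_pos.2 hx.2
        positivity) hpq
  obtain ⟨B, hB⟩ := (isCompact_Icc (a := p) (b := q)).exists_bound_of_continuousOn
    (f := fun x => 2 * χ x * |M| + |χ'' x| / 2) (by fun_prop)
  have hB0 : 0 ≤ B := (norm_nonneg _).trans (hB p ⟨le_rfl, hpq.le⟩)
  refine ⟨(B + 1) / ∫ x in p..q, χ x, by positivity, ?_⟩
  intro h E V G G' hG hh hh1 hEM hVc hVs hV0 hV' hint
  set e : ℝ → ℝ := fun y => h ^ 2 * G' y ^ 2 + (E - V y) * G y ^ 2 with he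
  have hanti : AntitoneOn e (Ioc 0 b) :=
    antitoneOn_of_hasDerivAt_nonpos (convex_Ioc 0 b)
      (fun x hx => hG.hasDerivAt_energy hh hx.1
        ((hVs.differentiableOn (by norm_num)).differentiableAt (Ioi_mem_nhds hx.1)))
      (fun x hx => neg_nonpos.2 (mul_nonneg (hV' x hx) (sq_nonneg _)))
  have hsub : uIcc p q ⊆ Ioi 0 := by
    rw [uIcc_of_le hpq.le]; exact fun x hx => hp.trans_le hx.1
  have hcV := hVc.mono (hsub.trans Ioi_subset_Ici_self)
  have hcG := hG.continuousOn.mono hsub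
  have hcG' := hG.continuousOn'.mono hsub
  have hc1 : ContinuousOn (fun x => χ x * (h ^ 2 * G' x ^ 2)) (uIcc p q) := by fun_prop
  have hc2 : ContinuousOn (fun x => χ x * ((E - V x) * G x ^ 2)) (uIcc p q) := by fun_prop
  have hc3 : ContinuousOn (fun x => (χ x * (E - V x) + h ^ 2 * χ'' x / 2) * G x ^ 2)
      (uIcc p q) := by fun_prop
  have hvir := hG.virial hh hp hpq.le hVc hχ hχ' hχc'' (by simp [χ]) (by simp [χ])
    (by simp [χ']) (by simp [χ'])
  have hlow : (∫ x in p..q, χ x) * e b ≤ ∫ x in p..q, χ x * e x := by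
    rw [← intervalIntegral.integral_mul_const]
    refine intervalIntegral.integral_mono_on hpq.le
      (by exact (hχc.mul continuous_const).intervalIntegrable _ _)
      (ContinuousOn.intervalIntegrable (by simp only [he]; fun_prop)) fun x hx => ?_
    have hxb : x ≤ b := hx.2.trans hqb.le
    exact mul_le_mul_of_nonneg_left
      (hanti ⟨hp.trans_le hx.1, hxb⟩ ⟨hb, le_rfl⟩ hxb) (sq_nonneg _)
  have hsplit : ∫ x in p..q, χ x * e x =
      ∫ x in p..q, (2 * χ x * (E - V x) + h ^ 2 * χ'' x / 2) * G x ^ 2 := by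
    have h1 : ∫ x in p..q, χ x * e x = (∫ x in p..q, χ x * (h ^ 2 * G' x ^ 2)) +
        ∫ x in p..q, χ x * ((E - V x) * G x ^ 2) := by
      rw [← intervalIntegral.integral_add hc1.intervalIntegrable hc2.intervalIntegrable]
      simp only [he, mul_add]
    rw [h1, hvir, ← intervalIntegral.integral_add hc3.intervalIntegrable hc2.intervalIntegrable]
    congr 1
    ext x
    ring
  have hu : IntervalIntegrable (fun x => G x ^ 2) volume 0 b :=
    (intervalIntegrable_iff_integrableOn_Ioc_of_le hb.le).2 (hint.mono_set Ioc_subset_Ioi_self)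
  have hup : ∫ x in p..q, (2 * χ x * (E - V x) + h ^ 2 * χ'' x / 2) * G x ^ 2 ≤
      ∫ x in p..q, (B + 1) * G x ^ 2 := by
    refine intervalIntegral.integral_mono_on hpq.le
      (ContinuousOn.intervalIntegrable (by fun_prop))
      (ContinuousOn.intervalIntegrable (by fun_prop)) fun x hx => ?_
    refine mul_le_mul_of_nonneg_right ?_ (sq_nonneg _)
    have h1 := (le_abs_self _).trans (hB x hx)
    have h2 : χ x * (E - V x) ≤ χ x * |M| := by
      refine mul_le_mul_of_nonneg_left ?_ (sq_nonneg _)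
      linarith [hV0 x ⟨hp.le.trans hx.1, hx.2.trans hqb.le⟩, le_abs_self M]
    have h3 : h ^ 2 * χ'' x ≤ |χ'' x| :=
      (mul_le_mul_of_nonneg_left (le_abs_self _) (sq_nonneg h)).trans
        (mul_le_of_le_one_left (abs_nonneg _) (pow_le_one₀ hh.le hh1))
    linarith
  have hmass : ∫ x in p..q, G x ^ 2 ≤ ∫ x in 0..b, G x ^ 2 :=
    intervalIntegral.integral_mono_interval hp.le hpq.le hqb.le
      (Filter.Eventually.of_forall fun x => sq_nonneg _) hu
  rw [intervalIntegral.integral_const_mul] at hup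
  have hfin : e b * (∫ x in p..q, χ x) ≤ (B + 1) * ∫ x in 0..b, G x ^ 2 := by
    have := mul_le_mul_of_nonneg_left hmass (by linarith : 0 ≤ B + 1)
    linarith
  rw [div_mul_eq_mul_div, le_div_iff₀ hS]
  exact hfin

/-! ### Uniformity over the family of potentials -/

theorem isCompact_restrictedWeights {γ b c d : ℝ} {𝒦 : Set (SmoothIcc d)} (h𝒦 : IsCompact 𝒦)
    {K : Set ℝ} (hclosed : IsClosed (restrictedWeights γ b c d 𝒦 K)) :
    IsCompact (restrictedWeights γ b c d 𝒦 K) := by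
  refine h𝒦.of_isClosed_subset hclosed ?_
  rintro w ⟨V, W, hVW, hw⟩
  obtain ⟨w', hw', hW⟩ := hVW.restrict_mem
  have : w = w' := Subtype.ext (funext fun x => (hw x).trans (hW x).symm)
  exact this ▸ hw'

theorem SmoothIcc.continuous_derivative_apply {d : ℝ} (k : ℕ) :
    Continuous fun z : SmoothIcc d × Icc (0 : ℝ) d => derivative k z.1 z.2 := by
  have h1 : Continuous (fun f : SmoothIcc d => derivative k f) :=
    (continuous_pi_iff.1 continuous_induced_dom : ∀ k : ℕ, Continuous (derivative k)) k
  exact continuous_eval.comp (h1.prodMap continuous_id)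

/-- The derivative of `V = x^γ W` on `(0,d]` in terms of the jet of the restriction of `W`. -/
theorem IsWell.deriv_eq {γ d : ℝ} {V W : ℝ → ℝ} (hV : IsWell γ d V W) {w : SmoothIcc d}
    (hw : ∀ x : Icc (0 : ℝ) d, w x = W x) (x : Icc (0 : ℝ) d) (hx : 0 < (x : ℝ)) :
    deriv V x = γ * (x : ℝ) ^ (γ - 1) * SmoothIcc.derivative 0 w x +
      (x : ℝ) ^ γ * SmoothIcc.derivative 1 w x := by
  have hd : 0 < d := hx.trans_le x.2.2
  have hEq : EqOn (extendZero w.1) W (Icc 0 d) := fun y hy => by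
    simp only [extendZero, hy, dif_pos]
    exact hw ⟨y, hy⟩
  have hW : HasDerivAt W (deriv W x) x :=
    (((hV.smooth_W.mono Ioi_subset_Ici_self).differentiableOn
      (by norm_num)).differentiableAt (Ioi_mem_nhds hx)).hasDerivAt
  have h0 : SmoothIcc.derivative 0 w x = W x := by
    simp [SmoothIcc.derivative, hEq x.2]
  have h1 : SmoothIcc.derivative 1 w x = deriv W x := by
    have : SmoothIcc.derivative 1 w x = derivWithin (extendZero w.1) (Icc 0 d) x := by
      simp [SmoothIcc.derivative, iteratedDerivWithin_one]
    rw [this, derivWithin_congr hEq (hEq x.2)]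
    exact hW.hasDerivWithinAt.derivWithin (uniqueDiffOn_Icc hd x x.2)
  have hVd : HasDerivAt V (γ * (x : ℝ) ^ (γ - 1) * W x + (x : ℝ) ^ γ * deriv W x) x := by
    refine ((Real.hasDerivAt_rpow_const (Or.inl hx.ne')).fun_mul hW).congr_of_eventuallyEq ?_
    filter_upwards [Ioi_mem_nhds hx] with y hy using hV.V_eq y hy
  rw [hVd.deriv, h0, h1]

/-- By compactness, `V'` is bounded below on `[b,d]` by a positive constant, uniformly in `V`. -/
theorem exists_forall_le_deriv {γ b c d : ℝ} (hb : 0 < b) {𝒦 : Set (SmoothIcc d)}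
    (h𝒦 : IsCompact 𝒦) {K : Set ℝ} (hclosed : IsClosed (restrictedWeights γ b c d 𝒦 K)) :
    ∃ κ > (0 : ℝ), ∀ V ∈ potentials γ b c d 𝒦 K, ∀ x ∈ Icc b d, κ ≤ deriv V x := by
  let S : Set (Icc (0 : ℝ) d) := {x | b ≤ (x : ℝ)}
  let D : SmoothIcc d × Icc (0 : ℝ) d → ℝ := fun z =>
    γ * (z.2 : ℝ) ^ (γ - 1) * SmoothIcc.derivative 0 z.1 z.2 +
      (z.2 : ℝ) ^ γ * SmoothIcc.derivative 1 z.1 z.2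
  have hS : IsCompact S := (isClosed_le continuous_const continuous_subtype_val).isCompact
  have hc := (isCompact_restrictedWeights h𝒦 hclosed).prod hS
  have hD : ContinuousOn D (restrictedWeights γ b c d 𝒦 K ×ˢ S) := by
    have hr : ∀ r : ℝ, ContinuousOn
        (fun z : SmoothIcc d × Icc (0 : ℝ) d => (z.2 : ℝ) ^ r)
        (restrictedWeights γ b c d 𝒦 K ×ˢ S) := fun r =>
      ContinuousOn.rpow_const (by fun_prop) fun z hz => Or.inl (hb.trans_le hz.2).ne'
    exact ((continuousOn_const.mul (hr _)).mul
      (SmoothIcc.continuous_derivative_apply 0).continuousOn).add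
      ((hr _).mul (SmoothIcc.continuous_derivative_apply 1).continuousOn)
  have hpos : ∀ z ∈ restrictedWeights γ b c d 𝒦 K ×ˢ S, 0 < D z := by
    rintro ⟨w, x⟩ ⟨⟨V, W, hVW, hw⟩, hx⟩
    have hx0 : 0 < (x : ℝ) := hb.trans_le hx
    have := hVW.well.deriv_pos x ⟨hx0, x.2.2⟩
    rwa [hVW.well.deriv_eq hw x hx0] at this
  have hmem : ∀ V ∈ potentials γ b c d 𝒦 K, ∀ x ∈ Icc b d,
      ∃ z ∈ restrictedWeights γ b c d 𝒦 K ×ˢ S, deriv V x = D z := by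
    rintro V ⟨W, hVW⟩ x hx
    obtain ⟨w, -, hw⟩ := hVW.restrict_mem
    exact ⟨(w, ⟨x, hb.le.trans hx.1, hx.2⟩), ⟨⟨V, W, hVW, hw⟩, hx.1⟩,
      hVW.well.deriv_eq hw ⟨x, hb.le.trans hx.1, hx.2⟩ (hb.trans_le hx.1)⟩
  obtain ⟨κ, hκ, hle⟩ := hc.exists_forall_le' hD hpos
  refine ⟨κ, hκ, fun V hV x hx => ?_⟩
  obtain ⟨z, hz, hzD⟩ := hmem V hV x hx
  exact hzD ▸ hle z hz

theorem IsWell.nonneg {γ d : ℝ} {V W : ℝ → ℝ} (hV : IsWell γ d V W) {x : ℝ}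
    (hx : x ∈ Icc 0 d) : 0 ≤ V x := by
  have hmono : MonotoneOn V (Icc 0 d) := by
    refine monotoneOn_of_deriv_nonneg (convex_Icc 0 d)
      (hV.continuous_V.mono Icc_subset_Ici_self) ?_ ?_
    · rw [interior_Icc]
      exact (hV.smooth_V.differentiableOn (by norm_num)).mono Ioo_subset_Ioi_self
    · rw [interior_Icc]
      exact fun y hy => (hV.deriv_pos y ⟨hy.1, hy.2.le⟩).le
  have := hmono ⟨le_rfl, hx.1.trans hx.2⟩ hx hx.1
  rwa [hV.V_zero] at this

end SchrodingerWell

/-! ### The lower bound on the mass -/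

open SchrodingerWell in
theorem mainTheorem4 (γ b c d : ℝ) (hγ : 0 < γ) (hb : 0 < b) (hbc : b < c) (hcd : c < d)
    (𝒦 : Set (SchrodingerWell.SmoothIcc d)) (h𝒦 : IsCompact 𝒦)
    (K : Set ℝ) (hK : IsCompact K) (hKpos : K ⊆ Set.Ioi 0)
    (hclosed : IsClosed (SchrodingerWell.restrictedWeights γ b c d 𝒦 K)) :
    ∃ m > (0 : ℝ), ∃ h₀ > (0 : ℝ), ∀ h : ℝ, 0 < h → h ≤ h₀ →
      ∀ V ∈ SchrodingerWell.potentials γ b c d 𝒦 K, ∀ E ∈ K,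
        ∀ G : ℝ → ℝ, SchrodingerWell.IsNormalizedSolution h d E V G →
          m ≤ ∫ x in (0 : ℝ)..b, |G x| ^ 2 := by
  obtain ⟨M, hM⟩ := hK.bddAbove
  obtain ⟨κ, hκ, hκV⟩ := exists_forall_le_deriv hb h𝒦 hclosed
  obtain ⟨A, hA, henergy⟩ := HasDerivSolution.energy_le_integral (M := M) hb
  have hc : 0 < c := hb.trans hbc
  have hd : 0 < d := hc.trans hcd
  have hcd' : 0 < d - c := sub_pos.2 hcd
  have hsqrt : 0 < √(κ * (d - c)) := Real.sqrt_pos.2 (by positivity)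
  have hT : 0 < 1 + A / κ + A / κ / (d - c) / (2 * √(κ * (d - c))) := by positivity
  refine ⟨1 / (1 + A / κ + A / κ / (d - c) / (2 * √(κ * (d - c)))), by positivity, 1, one_pos, ?_⟩
  rintro h hh hh1 V hVmem E hE G hG
  obtain ⟨W, hVW⟩ := id hVmem
  have hwell := hVW.well
  have hsol := hG.hasDerivSolution hh
  have hint : IntegrableOn (fun x => G x ^ 2) (Ioi 0) := by
    simpa only [sq_abs] using hG.square_integrable
  have hnorm : ∫ x in Ioi (0 : ℝ), G x ^ 2 = 1 := by simpa only [sq_abs] using hG.normalized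
  simp only [sq_abs]
  have hEd : E < V d := sub_pos.1 (hVW.forbidden E hE d ⟨hcd.le, le_rfl⟩)
  have hEV : ∀ x, c ≤ x → E ≤ V x := fun x hx => by
    rcases le_total x d with hxd | hxd
    · exact (sub_pos.1 (hVW.forbidden E hE x ⟨hx, hxd⟩)).le
    · exact hEd.le.trans (hwell.V_ge x hxd)
  -- The gap at `d` comes from the slope of `V` on `[c,d]`.
  have hgap : √(κ * (d - c)) ^ 2 ≤ V d - E := by
    rw [Real.sq_sqrt (by positivity)]
    have hdiff : DifferentiableOn ℝ V (Icc c d) :=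
      (hwell.smooth_V.differentiableOn (by norm_num)).mono fun x hx => hc.trans_le hx.1
    have h1 := (convex_Icc c d).mul_sub_le_image_sub_of_le_deriv hdiff.continuousOn
      (hdiff.mono interior_subset) (C := κ)
      (fun x hx => hκV V hVmem x
        ⟨hbc.le.trans (interior_subset hx).1, (interior_subset hx).2⟩)
      c ⟨le_rfl, hcd.le⟩ d ⟨hcd.le, le_rfl⟩ hcd.le
    linarith [hEV c le_rfl]
  have hii : ∀ x y : ℝ, 0 ≤ x → x ≤ y → IntervalIntegrable (fun x => G x ^ 2) volume x y :=
    fun x y hx hxy => (intervalIntegrable_iff_integrableOn_Ioc_of_le hxy).2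
      (hint.mono_set fun z hz => hx.trans_lt hz.1)
  set I := ∫ x in (0 : ℝ)..b, G x ^ 2 with hI
  have hmid : ∫ x in b..d, G x ^ 2 ≤ A / κ * I := by
    have h1 := hsol.integral_le_energy hh hb (hbc.trans hcd).le hwell.smooth_V (hκV V hVmem)
      (by linarith [hsol.le_sq_deriv hh hint hd hEd hwell.V_ge le_rfl])
    have h2 := henergy h E V G _ hsol hh hh1 (hM hE) hwell.continuous_V hwell.smooth_V
      (fun x hx => hwell.nonneg ⟨hx.1, hx.2.trans (hbc.trans hcd).le⟩)
      (fun x hx => (hwell.deriv_pos x ⟨hx.1, hx.2.trans (hbc.trans hcd).le⟩).le) hint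
    rw [div_mul_eq_mul_div, le_div_iff₀ hκ]
    linarith
  have hGd : G d ^ 2 ≤ A / κ / (d - c) * I := by
    have hanti : AntitoneOn (fun y => G y ^ 2) (Ici c) :=
      antitoneOn_of_hasDerivAt_nonpos (convex_Ici c)
        (fun x hx => hsol.hasDerivAt_sq (hc.trans_le hx))
        (fun x hx => by linarith [hsol.mul_deriv_nonpos hint hc hEV hx])
    have h1 : ∫ _ in c..d, G d ^ 2 ≤ ∫ x in c..d, G x ^ 2 :=
      intervalIntegral.integral_mono_on hcd.le (by simp) (hii c d hc.le hcd.le)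
        fun x hx => hanti hx.1 hcd.le hx.2
    have h2 : ∫ x in c..d, G x ^ 2 ≤ ∫ x in b..d, G x ^ 2 :=
      intervalIntegral.integral_mono_interval hbc.le hcd.le le_rfl
        (Filter.Eventually.of_forall fun x => sq_nonneg _) (hii b d hb.le (hbc.trans hcd).le)
    rw [intervalIntegral.integral_const, smul_eq_mul] at h1
    rw [div_mul_eq_mul_div, le_div_iff₀ hcd']
    linarith
  have htail : ∫ x in Ioi d, G x ^ 2 ≤ A / κ / (d - c) / (2 * √(κ * (d - c))) * I := by
    have h1 := hsol.tail_le hh hh1 hint hd hsqrt hgap hwell.V_ge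
    rw [div_mul_eq_mul_div, le_div_iff₀ (by positivity)]
    linarith
  have hsum : I + (∫ x in b..d, G x ^ 2) + ∫ x in Ioi d, G x ^ 2 = 1 := by
    rw [hI, intervalIntegral.integral_add_adjacent_intervals (hii 0 b le_rfl hb.le)
      (hii b d hb.le (hbc.trans hcd).le), ← hnorm]
    exact intervalIntegral.integral_interval_add_Ioi hint (hint.mono_set (Ioi_subset_Ioi hd.le))
  rw [div_le_iff₀ hT]
  linarith
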